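/- Let $\mathcal S$ be the class of functions $f$ that are analytic and univalent (injective) in the open unit disk $\{z\in\mathbb C:|z|<1\}$ with $f(z)=z+a_2z^2+a_3z^3+\cdots$, and define the logarithmic coefficients $\gamma_n$ of $f\in\mathcal S$ by $$\log\frac{f(z)}{z}=2\sum_{n=1}^\infty\gamma_nz^n ,$$ where the branch of the logarithm vanishes at $z=0$. Let $$M=\max\Big\{\tfrac14x^4+\tfrac12y^2+x^2y+xz+t\;:\;x,y,z,t\ge 0,\ x^2+3y^2+5z^2+7t^2\le 1\Big\}.$$ Then $0.51059\le M<0.51060$, that is, $M=0.51059\ldots$, and for every $f\in\mathcal S$, $$|\gamma_4|\le M=0.51059\ldots .$$ -/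

import Mathlib

/-- The class `S` of normalized univalent functions: `f` is analytic and injective in the open unit
disk, with `f(z) = z + a₂ z² + a₃ z³ + ⋯`.  Only the values of `f` in the disk matter. -/
structure IsClassS (f : ℂ → ℂ) : Prop where
  differentiableOn : DifferentiableOn ℂ f (Metric.ball 0 1)
  injOn : Set.InjOn f (Metric.ball 0 1)
  map_zero : f 0 = 0
  deriv_zero : deriv f 0 = 1

/-- The `n`-th logarithmic coefficient `γₙ` of `f`, given by `log (f(z)/z) = 2 ∑_{n ≥ 1} γₙ zⁿ`,
that is, half of the `n`-th Taylor coefficient at `0` of `log (f(z)/z)`.  When `f 0 = 0`, the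
function `dslope f 0` is `f(z)/z` for `z ≠ 0` and `f'(0)` at `z = 0`.  For `f` in the class `S` it
equals `1` at `0`, so that near `0` the principal logarithm is the branch that vanishes at `0`. -/
noncomputable def logCoeff (f : ℂ → ℂ) (n : ℕ) : ℂ :=
  (iteratedDeriv n (fun z => Complex.log (dslope f 0 z)) 0 / (n.factorial : ℂ)) / 2

/-- The set of values of `x⁴/4 + y²/2 + x² y + x z + t` on the region
`x, y, z, t ≥ 0`, `x² + 3y² + 5z² + 7t² ≤ 1`. -/
def boundValues : Set ℝ :=
  {m | ∃ x y z t : ℝ, 0 ≤ x ∧ 0 ≤ y ∧ 0 ≤ z ∧ 0 ≤ t ∧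
    x ^ 2 + 3 * y ^ 2 + 5 * z ^ 2 + 7 * t ^ 2 ≤ 1 ∧
    m = x ^ 4 / 4 + y ^ 2 / 2 + x ^ 2 * y + x * z + t}

open Complex Metric Filter Topology MeasureTheory

/-! Write f(z) = z g(z) with g nonvanishing on the disc, g = exp L with L(0) = 0, and φ = exp(-L/2)
= 1 - c₁z - c₂z² - ⋯. The odd function h(z) = φ(z²)/z satisfies h(z)² = 1/f(z²), so it inherits
injectivity from f on the punctured disc and has a simple pole at 0. The area theorem for h gives
|c₁|² + 3|c₂|² + 5|c₃|² + 7|c₄|² ≤ 1 (`area_theorem`). Since L = -2 log φ, the fourth logarithmic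
coefficient is c₄ + c₁c₃ + c₂²/2 + c₁²c₂ + c₁⁴/4, and the triangle inequality puts its modulus below
an element of `boundValues`.

The area theorem comes from bounding the area of the image of ε < |z| < r on both sides: from below
by integrating |h'|² with a truncated Parseval identity, from above by an ellipse around the image
of |z| = ε. The divergent terms 1/ε² cancel as ε → 0.

The maximum M exists by compactness. An explicit point bounds it below, and a Lagrangian estimate
bounds it above. -/

/-! ### The real extremal problem -/

/-- The Lagrangian bound that remains once y, z and t are eliminated, with s = x² and multiplier 1/4
+ 59s/100. A constant multiplier would leave a convex function of s, whose critical point cannot be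
a maximum; hence the dependence on s. -/
theorem quartic_bound {s : ℝ} (h0 : 0 ≤ s) :
    (1 / 4 + 59 / 100 * s) * (1 - s) + s ^ 2 / 4 + s ^ 2 / (4 * (1 / 4 + 177 / 100 * s))
      + s / (20 * (1 / 4 + 59 / 100 * s)) + 1 / (28 * (1 / 4 + 59 / 100 * s)) ≤ 0.510598 := by
  have e1 : 0 < 1 / 4 + 177 / 100 * s := by positivity
  have e2 : 0 < 1 / 4 + 59 / 100 * s := by positivity
  rw [← sub_nonneg]
  have : 0.510598 - ((1 / 4 + 59 / 100 * s) * (1 - s) + s ^ 2 / 4 + s ^ 2 / (4 * (1 / 4 + 177 / 100 * s))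
      + s / (20 * (1 / 4 + 59 / 100 * s)) + 1 / (28 * (1 / 4 + 59 / 100 * s))) = 
      (0.510598 * (1 / 4 + 177 / 100 * s) * (1 / 4 + 59 / 100 * s) 
       - ((1 / 4 + 59 / 100 * s) * (1 - s) + s ^ 2 / 4) * (1 / 4 + 177 / 100 * s) * (1 / 4 + 59 / 100 * s)
       - s ^ 2 / 4 * (1 / 4 + 59 / 100 * s) - (s / 20 + 1 / 28) * (1 / 4 + 177 / 100 * s)) /
       ((1 / 4 + 177 / 100 * s) * (1 / 4 + 59 / 100 * s)) := by
    field_simp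
    ring
  rw [this]
  refine div_nonneg ?_ (by positivity)
  -- The numerator is a quartic in s that nearly vanishes at s ≈ 0.67087, the value of x² at the
  -- maximizer.
  nlinarith [mul_nonneg h0 (sq_nonneg (s - 0.67087)), sq_nonneg (s - 0.67087), 
    mul_nonneg h0 (mul_nonneg h0 (sq_nonneg (s - 0.67087))), sq_nonneg (s * (s - 0.67087))]

/-- Weak duality: l times the constraint is added, and the terms in y, z, t are bounded by
completing squares. The coefficient p = 3l - 1/2 is what remains for y² after y²/2 is absorbed. -/
theorem boundValues_le {m : ℝ} (hm : m ∈ boundValues) : m ≤ 0.510598 := by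
  obtain ⟨x, y, z, t, hx, hy, hz, ht, h, rfl⟩ := hm
  have hs0 : 0 ≤ x ^ 2 := sq_nonneg x
  have hq := quartic_bound hs0
  have e1 : 0 < 1 / 4 + 177 / 100 * x ^ 2 := by positivity
  have e2 : 0 < 1 / 4 + 59 / 100 * x ^ 2 := by positivity
  set l := 1 / 4 + 59 / 100 * x ^ 2 with hl
  set p := 1 / 4 + 177 / 100 * x ^ 2 with hp
  have h1 : x ^ 2 * y ≤ p * y ^ 2 + (x ^ 2) ^ 2 / (4 * p) := by
    have : p * y ^ 2 + (x ^ 2) ^ 2 / (4 * p) - x ^ 2 * y = (2 * p * y - x ^ 2) ^ 2 / (4 * p) := by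
      field_simp; ring
    have : 0 ≤ (2 * p * y - x ^ 2) ^ 2 / (4 * p) := by positivity
    linarith
  have h2 : x * z ≤ 5 * l * z ^ 2 + x ^ 2 / (20 * l) := by
    have : 5 * l * z ^ 2 + x ^ 2 / (20 * l) - x * z = (10 * l * z - x) ^ 2 / (20 * l) := by
      field_simp; ring
    have : 0 ≤ (10 * l * z - x) ^ 2 / (20 * l) := by positivity
    linarith
  have h3 : t ≤ 7 * l * t ^ 2 + 1 / (28 * l) := by
    have : 7 * l * t ^ 2 + 1 / (28 * l) - t = (14 * l * t - 1) ^ 2 / (28 * l) := by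
      field_simp; ring
    have : 0 ≤ (14 * l * t - 1) ^ 2 / (28 * l) := by positivity
    linarith
  have h4 : l * (x ^ 2 + 3 * y ^ 2 + 5 * z ^ 2 + 7 * t ^ 2) ≤ l := by
    simpa using mul_le_mul_of_nonneg_left h e2.le
  have hpl : p = 3 * l - 1 / 2 := by rw [hp, hl]; ring
  have h5 : p * y ^ 2 = 3 * l * y ^ 2 - y ^ 2 / 2 := by rw [hpl]; ring
  nlinarith

theorem exists_boundValues_ge : ∃ m ∈ boundValues, (0.51059 : ℝ) ≤ m :=
  -- Approximate solution of the Lagrange conditions y = x²/(6λ - 1), z = x/(10λ), t = 1/(14λ) with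
  -- λ ≈ 0.646.
  ⟨_, ⟨0.81907042, 0.23323544, 0.12677829, 0.11055938, by norm_num, by norm_num, by norm_num,
    by norm_num, by norm_num, rfl⟩, by norm_num⟩

theorem isCompact_boundValues : IsCompact boundValues := by
  let K : Set (ℝ × ℝ × ℝ × ℝ) := {p | 0 ≤ p.1 ∧ 0 ≤ p.2.1 ∧ 0 ≤ p.2.2.1 ∧ 0 ≤ p.2.2.2 ∧
    p.1 ^ 2 + 3 * p.2.1 ^ 2 + 5 * p.2.2.1 ^ 2 + 7 * p.2.2.2 ^ 2 ≤ 1}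
  have hK : IsCompact K := by
    refine IsCompact.of_isClosed_subset (isCompact_Icc (a := (0 : ℝ × ℝ × ℝ × ℝ)) (b := 1)) ?_ ?_
    · simp only [K, Set.ofPred_and]
      refine IsClosed.inter ?_ (IsClosed.inter ?_ (IsClosed.inter ?_ (IsClosed.inter ?_ ?_))) <;>
        exact isClosed_le (by fun_prop) (by fun_prop)
    · rintro ⟨x, y, z, t⟩ ⟨hx, hy, hz, ht, h⟩
      simp only at hx hy hz ht h
      have hle : ∀ u : ℝ, u ^ 2 ≤ 1 → u ≤ 1 := fun u hu => by nlinarith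
      refine ⟨⟨hx, hy, hz, ht⟩, hle _ ?_, hle _ ?_, hle _ ?_, hle _ ?_⟩ <;>
        simp only <;> nlinarith [sq_nonneg x, sq_nonneg y, sq_nonneg z, sq_nonneg t]
  have : boundValues = (fun p : ℝ × ℝ × ℝ × ℝ => p.1 ^ 4 / 4 + p.2.1 ^ 2 / 2 + p.1 ^ 2 * p.2.1
      + p.1 * p.2.2.1 + p.2.2.2) '' K := by
    ext m
    constructor
    · rintro ⟨x, y, z, t, hx, hy, hz, ht, h, rfl⟩
      exact ⟨(x, y, z, t), ⟨hx, hy, hz, ht, h⟩, rfl⟩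
    · rintro ⟨⟨x, y, z, t⟩, ⟨hx, hy, hz, ht, h⟩, rfl⟩
      exact ⟨x, y, z, t, hx, hy, hz, ht, h, rfl⟩
  rw [this]
  exact hK.image (by fun_prop)

/-! ### Truncated Parseval identity on circles -/

/-- The cross term is twice the real part of a holomorphic function vanishing at 0, so its mean is
zero. Iteration peels off one Taylor coefficient at a time, with no infinite series. -/
theorem circleAverage_norm_sq_const_add_pow_mul {B : ℂ → ℂ} {R ρ : ℝ} {m : ℕ} (hm : m ≠ 0) (a : ℂ)
    (hB : DifferentiableOn ℂ B (ball 0 R)) (hρ : 0 ≤ ρ) (hρR : ρ < R) :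
    Real.circleAverage (fun z => ‖a + z ^ m * B z‖ ^ 2) 0 ρ =
      ‖a‖ ^ 2 + (ρ ^ m) ^ 2 * Real.circleAverage (fun z => ‖B z‖ ^ 2) 0 ρ := by
  have hsub : closedBall (0 : ℂ) ρ ⊆ ball 0 R := closedBall_subset_ball hρR
  have hsub' : sphere (0 : ℂ) ρ ⊆ ball 0 R := sphere_subset_closedBall.trans hsub
  have hBc : ContinuousOn B (sphere 0 ρ) := hB.continuousOn.mono hsub'
  let g : ℂ → ℂ := fun z => (starRingEnd ℂ) a * (z ^ m * B z)
  have hgd : DifferentiableOn ℂ g (ball 0 R) := by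
    intro z hz
    have := hB z hz
    fun_prop
  have hmean : Real.circleAverage g 0 ρ = 0 := by
    have hd : DiffContOnCl ℂ g (ball 0 |ρ|) := by
      rw [abs_of_nonneg hρ]
      exact (hgd.mono hsub).diffContOnCl_ball subset_rfl
    rw [hd.circleAverage]
    simp [g, hm]
  have hgi : CircleIntegrable g 0 ρ :=
    (hgd.continuousOn.mono hsub').circleIntegrable hρ
  have hre : Real.circleAverage (fun z => (g z).re) 0 ρ = 0 := by
    have := reCLM.circleAverage_comp_comm hgi
    rw [hmean] at this
    simpa [Function.comp_def] using this
  have hrei : CircleIntegrable (fun z => (g z).re) 0 ρ := by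
    apply ContinuousOn.circleIntegrable hρ
    exact Complex.continuous_re.comp_continuousOn (hgd.continuousOn.mono hsub')
  have hBi : CircleIntegrable (fun z => ‖B z‖ ^ 2) 0 ρ :=
    ContinuousOn.circleIntegrable hρ (by fun_prop)
  have key : Real.circleAverage (fun z => ‖a + z ^ m * B z‖ ^ 2) 0 ρ =
      Real.circleAverage (fun z => (‖a‖ ^ 2 + 2 * (g z).re) + (ρ ^ m) ^ 2 * ‖B z‖ ^ 2) 0 ρ := by
    apply Real.circleAverage_congr_sphere
    intro z hz
    have hz' : ‖z‖ = ρ := by simpa [abs_of_nonneg hρ] using hz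
    have h1 : ‖z ^ m * B z‖ ^ 2 = (ρ ^ m) ^ 2 * ‖B z‖ ^ 2 := by
      rw [norm_mul, norm_pow, hz']; ring
    simp only [← h1]
    rw [← Complex.normSq_eq_norm_sq, ← Complex.normSq_eq_norm_sq, ← Complex.normSq_eq_norm_sq,
      Complex.normSq_add]
    have : (a * (starRingEnd ℂ) (z ^ m * B z)).re = (g z).re := by
      simp only [g, Complex.mul_re, Complex.conj_re, Complex.conj_im]; ring
    rw [this]; ring
  rw [key, Real.circleAverage_fun_add, Real.circleAverage_fun_add (circleIntegrable_const _ _ _)]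
  · rw [Real.circleAverage_const]
    have e1 := Real.circleAverage_fun_smul (a := (2 : ℝ)) (f := fun z => (g z).re) (c := 0) (R := ρ)
    have e2 := Real.circleAverage_fun_smul (a := (ρ ^ m) ^ 2) (f := fun z => ‖B z‖ ^ 2)
      (c := 0) (R := ρ)
    simp only [smul_eq_mul] at e1 e2
    rw [e1, e2, hre]; ring
  · exact hrei.const_fun_smul (a := (2:ℝ))
  · exact (circleIntegrable_const _ _ _).add (hrei.const_fun_smul (a := (2:ℝ)))
  · exact hBi.const_fun_smul (a := (ρ ^ m) ^ 2)

theorem le_circleAverage_norm_sq {χ : ℂ → ℂ} {R ρ : ℝ} (g₀ g₁ g₂ g₃ g₄ : ℂ)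
    (hχ : DifferentiableOn ℂ χ (ball 0 R)) (hρ : 0 ≤ ρ) (hρR : ρ < R) :
    ‖g₀‖ ^ 2 + ‖g₁‖ ^ 2 * ρ ^ 4 + ‖g₂‖ ^ 2 * ρ ^ 8 + ‖g₃‖ ^ 2 * ρ ^ 12 + ‖g₄‖ ^ 2 * ρ ^ 16 ≤
      Real.circleAverage (fun z => ‖g₀ + z ^ 2 * (g₁ + z ^ 2 * (g₂ + z ^ 2 * (g₃ + z ^ 2 *
        (g₄ + z ^ 2 * χ z))))‖ ^ 2) 0 ρ := by
  have h4 : DifferentiableOn ℂ (fun z => g₄ + z ^ 2 * χ z) (ball 0 R) := by fun_prop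
  have h3 : DifferentiableOn ℂ (fun z => g₃ + z ^ 2 * (g₄ + z ^ 2 * χ z)) (ball 0 R) := by fun_prop
  have h2 : DifferentiableOn ℂ (fun z => g₂ + z ^ 2 * (g₃ + z ^ 2 * (g₄ + z ^ 2 * χ z)))
    (ball 0 R) := by fun_prop
  have h1 : DifferentiableOn ℂ (fun z => g₁ + z ^ 2 * (g₂ + z ^ 2 * (g₃ + z ^ 2 *
    (g₄ + z ^ 2 * χ z)))) (ball 0 R) := by fun_prop
  rw [circleAverage_norm_sq_const_add_pow_mul two_ne_zero g₀ h1 hρ hρR,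
    circleAverage_norm_sq_const_add_pow_mul two_ne_zero g₁ h2 hρ hρR,
    circleAverage_norm_sq_const_add_pow_mul two_ne_zero g₂ h3 hρ hρR,
    circleAverage_norm_sq_const_add_pow_mul two_ne_zero g₃ h4 hρ hρR,
    circleAverage_norm_sq_const_add_pow_mul two_ne_zero g₄ hχ hρ hρR]
  have : 0 ≤ Real.circleAverage (fun z => ‖χ z‖ ^ 2) 0 ρ :=
    Real.circleAverage_nonneg_of_nonneg fun z _ => by positivity
  have : 0 ≤ ρ ^ 20 * Real.circleAverage (fun z => ‖χ z‖ ^ 2) 0 ρ := by positivity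
  linarith

/-! ### Separation of the images of the inner and outer regions -/

theorem isPreconnected_setOf_lt_norm_complex {ρ : ℝ} (hρ : 0 < ρ) :
    IsPreconnected {u : ℂ | ρ < ‖u‖} := by
  have : {u : ℂ | ρ < ‖u‖} = Complex.exp '' {s : ℂ | Real.log ρ < s.re} := by
    ext u
    constructor
    · intro hu
      have hu' : ρ < ‖u‖ := hu
      have hu0 : u ≠ 0 := norm_pos_iff.1 (hρ.trans hu')
      exact ⟨Complex.log u, by simpa [Complex.log_re] using Real.log_lt_log hρ hu',
        Complex.exp_log hu0⟩
    · rintro ⟨s, hs, rfl⟩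
      have hs' : Real.log ρ < s.re := hs
      simpa [Complex.norm_exp] using (Real.log_lt_iff_lt_exp hρ).1 hs'
  rw [this]
  exact (convex_halfSpace_re_gt _).isPreconnected.image _ Complex.continuous_exp.continuousOn

/-- The image of the exterior part of the punctured disc under an injective function with a simple
pole at the origin is contained in any bounded set with connected complement that contains
the image of the separating circle. -/
theorem mem_of_sphere_subset {φ : ℂ → ℂ} (hφ : DifferentiableOn ℂ φ (ball 0 1)) (hφ0 : φ 0 = 1)
    (hinj : Set.InjOn (fun z => φ (z ^ 2) / z) (ball 0 1 \ {0})) {E : Set ℂ}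
    (hEb : Bornology.IsBounded E) (hEc : IsPreconnected Eᶜ) {ε : ℝ} (hε0 : 0 < ε)
    (hε1 : ε < 1) (hsph : ∀ z : ℂ, ‖z‖ = ε → φ (z ^ 2) / z ∈ E) {z : ℂ} (hεz : ε < ‖z‖)
    (hz : ‖z‖ < 1) : φ (z ^ 2) / z ∈ E := by
  set h : ℂ → ℂ := fun z => φ (z ^ 2) / z with hh
  have hsq : ∀ z : ℂ, ‖z‖ < 1 → ‖z ^ 2‖ < 1 := fun z hz => by
    rw [norm_pow]; exact pow_lt_one₀ (norm_nonneg _) hz two_ne_zero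
  have hopen : IsOpen (ball (0 : ℂ) 1 \ {0}) := isOpen_ball.sdiff isClosed_singleton
  have hdiff : DifferentiableOn ℂ h (ball 0 1 \ {0}) := by
    refine DifferentiableOn.div ?_ differentiableOn_id fun z hz => hz.2
    refine hφ.comp (by fun_prop) fun z hz => ?_
    simpa using hsq z (by simpa using hz.1)
  have hana : ∀ z ∈ ball (0 : ℂ) 1 \ {0}, AnalyticAt ℂ h z := fun z hz =>
    hdiff.analyticAt (hopen.mem_nhds hz)
  have hmap : ∀ z ∈ ball (0 : ℂ) 1 \ {0}, 𝓝 (h z) ≤ map h (𝓝 z) := by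
    intro z hz
    refine (hana z hz).eventually_constant_or_nhds_le_map_nhds.resolve_left fun hc => ?_
    have h1 : ∀ᶠ w in 𝓝[≠] z, h w = h z ∧ w ∈ ball (0 : ℂ) 1 \ {0} ∧ w ≠ z :=
      (hc.filter_mono nhdsWithin_le_nhds).and
        (((hopen.eventually_mem hz).filter_mono
          nhdsWithin_le_nhds).and self_mem_nhdsWithin)
    obtain ⟨w, hw1, hw2, hw3⟩ := h1.exists
    exact hw3 (hinj hw2 hz hw1)
  set V : Set ℂ := h '' (ball 0 ε \ {0}) with hV
  have hVsub : ball (0 : ℂ) ε \ {0} ⊆ ball 0 1 \ {0} :=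
    Set.sdiff_subset_sdiff_left (ball_subset_ball hε1.le)
  have hVopen : IsOpen V := by
    rw [isOpen_iff_mem_nhds]
    rintro _ ⟨w, hw, rfl⟩
    exact hmap w (hVsub hw)
      (image_mem_map ((isOpen_ball.sdiff isClosed_singleton).mem_nhds hw))
  have hcont : ContinuousOn (fun z => φ (z ^ 2)) (closedBall 0 ε) := by
    refine hφ.continuousOn.comp (by fun_prop) fun z hz => ?_
    simpa using hsq z (lt_of_le_of_lt (by simpa using hz) hε1)
  -- V is thus open and relatively closed in the connected set `Eᶜ`. It meets `Eᶜ` because of the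
  -- pole, so it contains `Eᶜ`, and injectivity then keeps outer points out of `Eᶜ`.
  have hclos : closure V ∩ Eᶜ ⊆ V := by
    rintro w ⟨hw, hwE⟩
    obtain ⟨x, hx, hxw⟩ := mem_closure_iff_seq_limit.1 hw
    choose y hy hyx using hx
    have hyc : ∀ n, y n ∈ closedBall (0 : ℂ) ε := fun n => ball_subset_closedBall (hy n).1
    obtain ⟨a, ha, k, hk, hka⟩ := (isCompact_closedBall (0 : ℂ) ε).tendsto_subseq hyc
    -- Multiplying by the variable clears the pole: in the limit w * a = φ(a²), which excludes a = 0
    -- because φ(0) = 1.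
    have h1 : Tendsto (fun n => x (k n) * y (k n)) atTop (𝓝 (w * a)) :=
      (hxw.comp hk.tendsto_atTop).mul hka
    have h2 : Tendsto (fun n => φ (y (k n) ^ 2)) atTop (𝓝 (φ (a ^ 2))) :=
      ((hcont a ha).tendsto.comp (tendsto_nhdsWithin_iff.2
        ⟨hka, Eventually.of_forall fun n => hyc (k n)⟩))
    have h3 : w * a = φ (a ^ 2) := by
      refine tendsto_nhds_unique h1 (h2.congr fun n => ?_)
      have hy0 : y (k n) ≠ 0 := (hy (k n)).2
      rw [← hyx (k n)]
      simp only [hh]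
      field_simp
    have ha0 : a ≠ 0 := by
      rintro rfl
      simp [hφ0] at h3
    have h4 : w = h a := by simp only [hh]; rw [← h3]; field_simp
    have ha' : ‖a‖ ≤ ε := by simpa using ha
    rcases ha'.lt_or_eq with hlt | heq
    · exact ⟨a, ⟨by simpa using hlt, ha0⟩, h4.symm⟩
    · exact absurd (h4 ▸ hsph a heq) hwE
  have hne : (Eᶜ ∩ V).Nonempty := by
    obtain ⟨C, hC⟩ := hEb.subset_closedBall 0
    have h1 : Tendsto (fun z : ℂ => ‖φ (z ^ 2)‖ * ‖z‖⁻¹) (𝓝[≠] 0) atTop := by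
      refine Tendsto.pos_mul_atTop (C := 1) one_pos ?_ ?_
      · have : ContinuousAt (fun z : ℂ => ‖φ (z ^ 2)‖) 0 :=
          (hcont.continuousAt (closedBall_mem_nhds 0 hε0)).norm
        have h2 := this.tendsto.mono_left (nhdsWithin_le_nhds (s := {0}ᶜ))
        simpa [hφ0] using h2
      · exact tendsto_inv_nhdsGT_zero.comp tendsto_norm_nhdsNE_zero
    have h2 : ∀ᶠ z : ℂ in 𝓝[≠] 0, C < ‖φ (z ^ 2)‖ * ‖z‖⁻¹ ∧ z ∈ ball (0 : ℂ) ε ∧ z ≠ 0 :=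
      (h1.eventually_gt_atTop C).and
        (((isOpen_ball.eventually_mem (mem_ball_self hε0)).filter_mono
          nhdsWithin_le_nhds).and self_mem_nhdsWithin)
    obtain ⟨z, hz1, hz2, hz3⟩ := h2.exists
    refine ⟨h z, fun hmem => ?_, z, ⟨hz2, hz3⟩, rfl⟩
    have := hC hmem
    simp only [hh, mem_closedBall, dist_zero_right, norm_div] at this
    rw [div_eq_mul_inv] at this
    linarith
  have hsub := hEc.subset_of_closure_inter_subset hVopen hne hclos
  by_contra hzE
  obtain ⟨w, hw, hwz⟩ := hsub hzE
  have hz0 : z ≠ 0 := norm_pos_iff.1 (hε0.trans hεz)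
  have := hinj (hVsub hw) ⟨by simpa using hz, hz0⟩ hwz
  have hw1 : ‖w‖ < ε := by simpa using hw.1
  rw [this] at hw1
  linarith

/-! ### Areas of images: upper and lower bounds -/

theorem abs_det_smul_one_complex (c : ℂ) : |(c • (1 : ℂ →L[ℝ] ℂ)).det| = ‖c‖ ^ 2 := by
  have : (c • (1 : ℂ →L[ℝ] ℂ)).det = ‖c‖ ^ 2 := by
    rw [ContinuousLinearMap.det, ← LinearMap.det_toMatrix basisOneI, Matrix.det_fin_two,
      ← Complex.normSq_eq_norm_sq, Complex.normSq_apply]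
    simp [LinearMap.toMatrix_apply]
  rw [this, abs_of_nonneg (by positivity)]

/-- The real linear map `w ↦ w - a * conj w`. -/
noncomputable def subMulConj (a : ℂ) : ℂ →ₗ[ℝ] ℂ :=
  LinearMap.id - (LinearMap.mulLeft ℝ a).comp conjAe.toLinearMap

theorem subMulConj_apply (a w : ℂ) : subMulConj a w = w - a * (starRingEnd ℂ) w := rfl

theorem det_subMulConj (a : ℂ) : LinearMap.det (subMulConj a) = 1 - ‖a‖ ^ 2 := by
  rw [← LinearMap.det_toMatrix basisOneI, Matrix.det_fin_two,
      ← Complex.normSq_eq_norm_sq, Complex.normSq_apply]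
  simp [LinearMap.toMatrix_apply, subMulConj_apply]
  ring

theorem le_norm_subMulConj (a w : ℂ) : (1 - ‖a‖) * ‖w‖ ≤ ‖subMulConj a w‖ := by
  have := norm_sub_norm_le w (a * (starRingEnd ℂ) w)
  rw [norm_mul, Complex.norm_conj] at this
  rw [subMulConj_apply]
  linarith

theorem isPreconnected_setOf_lt_norm_subMulConj {a : ℂ} (ha : ‖a‖ < 1) {ρ : ℝ} (hρ : 0 < ρ) :
    IsPreconnected {w : ℂ | ρ < ‖subMulConj a w‖} := by
  have h0 : (1 - ‖a‖ ^ 2 : ℂ) ≠ 0 := by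
    have : 0 < 1 - ‖a‖ ^ 2 := by nlinarith [norm_nonneg a]
    exact_mod_cast this.ne'
  have hna : a * (starRingEnd ℂ) a = (‖a‖ : ℂ) ^ 2 := Complex.mul_conj' a
  let T : ℂ → ℂ := fun u => (u + a * (starRingEnd ℂ) u) / (1 - ‖a‖ ^ 2)
  have hT : Continuous T := by
    have := Complex.continuous_conj
    fun_prop
  have hST : ∀ u, subMulConj a (T u) = u := by
    intro u
    simp only [subMulConj_apply, T, map_div₀, map_add, map_mul, map_sub, map_one, map_pow,
      Complex.conj_conj, Complex.conj_ofReal]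
    field_simp
    linear_combination (-u) * hna
  have hTS : ∀ u, T (subMulConj a u) = u := by
    intro u
    simp only [subMulConj_apply, T, map_mul, map_sub, Complex.conj_conj]
    field_simp
    linear_combination (-u) * hna
  have : {w : ℂ | ρ < ‖subMulConj a w‖} = T '' {u | ρ < ‖u‖} := by
    ext w
    constructor
    · intro hw
      exact ⟨_, hw, hTS w⟩
    · rintro ⟨u, hu, rfl⟩
      simpa [hST] using hu
  rw [this]
  exact (isPreconnected_setOf_lt_norm_complex hρ).image _ hT.continuousOn

/-- On |z| = ε the leading part 1/z + dz traces an ellipse, which `subMulConj` with a = dε²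
straightens to a circle. The image lies in the preimage of a disc, whose area is the disc's divided
by the determinant 1 - |a|². An enclosing disc of radius 1/ε + |d|ε would leave an excess area 2π|d|
that survives ε → 0. -/
theorem volume_image_annulus_le {φ ψ : ℂ → ℂ} {d : ℂ} (hφ : DifferentiableOn ℂ φ (ball 0 1))
    (hφψ : ∀ w ∈ ball (0 : ℂ) 1, φ w = 1 + d * w + w ^ 2 * ψ w)
    (hinj : Set.InjOn (fun z => φ (z ^ 2) / z) (ball 0 1 \ {0})) {K ε r : ℝ} (hε0 : 0 < ε)
    (hε1 : ε ≤ 1 / 2) (hK : ∀ w ∈ closedBall (0 : ℂ) (1 / 2), ‖ψ w‖ ≤ K) (hr : r ≤ 1)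
    (hd : ‖d‖ * ε ^ 2 ≤ 1 / 2) :
    ENNReal.ofReal (1 - (‖d‖ * ε ^ 2) ^ 2) *
        volume ((fun z => φ (z ^ 2) / z) '' {z : ℂ | ε < ‖z‖ ∧ ‖z‖ < r}) ≤
      ENNReal.ofReal (Real.pi * ((1 - (‖d‖ * ε ^ 2) ^ 2) / ε + 2 * K * ε ^ 3) ^ 2) := by
  set a : ℂ := d * ε ^ 2 with ha
  have hna : ‖a‖ = ‖d‖ * ε ^ 2 := by simp [ha]
  rw [← hna] at hd ⊢
  have hK0 : 0 ≤ K := (norm_nonneg _).trans (hK 0 (by simp))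
  set ρ : ℝ := (1 - ‖a‖ ^ 2) / ε + 2 * K * ε ^ 3 with hρ
  have ha1 : 0 < 1 - ‖a‖ ^ 2 := by nlinarith [norm_nonneg a]
  have hρ0 : 0 < ρ := by positivity
  have hsph : ∀ z : ℂ, ‖z‖ = ε → φ (z ^ 2) / z ∈ {w : ℂ | ‖subMulConj a w‖ ≤ ρ} := by
    intro z hz
    have hz0 : z ≠ 0 := norm_pos_iff.1 (hz ▸ hε0)
    have hz2 : ‖z ^ 2‖ ≤ 1 / 2 := by rw [norm_pow, hz]; nlinarith
    have hzz : z * (starRingEnd ℂ) z = (ε : ℂ) ^ 2 := by rw [Complex.mul_conj', hz]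
    have hdd : d * (starRingEnd ℂ) d = (‖d‖ : ℂ) ^ 2 := Complex.mul_conj' d
    have hz0' : (starRingEnd ℂ) z ≠ 0 := (map_ne_zero _).2 hz0
    have hεc : (ε : ℂ) ≠ 0 := by exact_mod_cast hε0.ne'
    have e1 : φ (z ^ 2) / z = (z⁻¹ + d * z) + z ^ 3 * ψ (z ^ 2) := by
      have hz2' : ‖z ^ 2‖ < 1 := by linarith
      rw [hφψ _ (by simpa using hz2')]
      field_simp
    -- On this circle the conjugate of z is ε²/z, so a times the conjugate of 1/z equals dz and
    -- cancels it.
    have e2 : subMulConj a (z⁻¹ + d * z) = ((1 - ‖a‖ ^ 2 : ℝ) : ℂ) * z⁻¹ := by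
      rw [subMulConj_apply, map_add, map_mul, map_inv₀, ha]
      have e3 : ((starRingEnd ℂ) z) = ε ^ 2 * z⁻¹ := by rw [← hzz]; field_simp
      rw [← ha, hna, e3]
      push_cast
      simp only [ha]
      field_simp
      linear_combination (-ε ^ 4 : ℂ) * hdd
    have hψ : ‖ψ (z ^ 2)‖ ≤ K := hK _ (by simpa using hz2)
    have e4 : ‖subMulConj a (z ^ 3 * ψ (z ^ 2))‖ ≤ 2 * K * ε ^ 3 := by
      rw [subMulConj_apply]
      refine (norm_sub_le _ _).trans ?_
      rw [norm_mul a, Complex.norm_conj, norm_mul, norm_pow, hz]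
      have : ε ^ 3 * ‖ψ (z ^ 2)‖ ≤ ε ^ 3 * K := by gcongr
      have h0 : 0 ≤ ε ^ 3 * ‖ψ (z ^ 2)‖ := by positivity
      nlinarith [norm_nonneg a]
    show ‖subMulConj a (φ (z ^ 2) / z)‖ ≤ ρ
    rw [e1, map_add, e2]
    refine (norm_add_le _ _).trans (add_le_add ?_ e4)
    rw [norm_mul, Complex.norm_real, Real.norm_of_nonneg ha1.le, norm_inv, hz, div_eq_mul_inv]
  have hEb : Bornology.IsBounded {w : ℂ | ‖subMulConj a w‖ ≤ ρ} := by
    refine isBounded_closedBall.subset (s := _) (t := closedBall (0 : ℂ) (2 * ρ)) fun w hw => ?_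
    have h1 := le_norm_subMulConj a w
    have h2 : ‖subMulConj a w‖ ≤ ρ := hw
    have : ‖w‖ ≤ 2 * ρ := by nlinarith [norm_nonneg w]
    simpa using this
  have hEc : IsPreconnected {w : ℂ | ‖subMulConj a w‖ ≤ ρ}ᶜ := by
    have : {w : ℂ | ‖subMulConj a w‖ ≤ ρ}ᶜ = {w : ℂ | ρ < ‖subMulConj a w‖} := by
      ext w; simp
    rw [this]
    exact isPreconnected_setOf_lt_norm_subMulConj (by linarith) hρ0
  have hsub : subMulConj a '' ((fun z => φ (z ^ 2) / z) '' {z : ℂ | ε < ‖z‖ ∧ ‖z‖ < r}) ⊆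
      closedBall 0 ρ := by
    rintro _ ⟨_, ⟨z, ⟨hz1, hz2⟩, rfl⟩, rfl⟩
    have := mem_of_sphere_subset hφ (by simpa using hφψ 0 (by simp)) hinj hEb hEc hε0
      (by linarith) hsph hz1 (by linarith)
    simpa using this
  have hvol := measure_mono (μ := volume) hsub
  rw [Measure.addHaar_image_linearMap, det_subMulConj, abs_of_pos ha1,
    Complex.volume_closedBall] at hvol
  refine hvol.trans_eq ?_
  rw [mul_comm, ENNReal.ofReal_mul Real.pi_pos.le, ENNReal.ofReal_pow hρ0.le]
  congr 1
  rw [← NNReal.coe_real_pi, ENNReal.ofReal_coe_nnreal]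

theorem setLIntegral_annulus_ge {F : ℂ → ℝ} (hF : Measurable F) {ε r : ℝ} (hε : 0 < ε)
    (hFc : ContinuousOn F {z : ℂ | ε < ‖z‖ ∧ ‖z‖ < r}) (hF0 : ∀ z, 0 ≤ F z) {m : ℝ → ℝ}
    (hm : ∀ ρ ∈ Set.Ioo ε r, m ρ ≤ Real.circleAverage F 0 ρ) :
    ∫⁻ ρ in Set.Ioo ε r, ENNReal.ofReal (2 * Real.pi * (ρ * m ρ)) ≤
      ∫⁻ z in {z : ℂ | ε < ‖z‖ ∧ ‖z‖ < r}, ENNReal.ofReal (F z) := by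
  set A : Set ℂ := {z : ℂ | ε < ‖z‖ ∧ ‖z‖ < r} with hA
  have hAm : MeasurableSet A :=
    ((isOpen_lt continuous_const continuous_norm).inter
      (isOpen_lt continuous_norm continuous_const)).measurableSet
  set f : ℂ → ENNReal := A.indicator fun z => ENNReal.ofReal (F z) with hf
  have hfm : Measurable f := (ENNReal.measurable_ofReal.comp hF).indicator hAm
  have hsymm : Measurable fun p : ℝ × ℝ => Complex.polarCoord.symm p := by
    simp only [Complex.polarCoord_symm_apply]
    fun_prop
  rw [← lintegral_indicator hAm, ← hf, ← Complex.lintegral_comp_polarCoord_symm]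
  have htarget : polarCoord.target = Set.Ioi (0 : ℝ) ×ˢ Set.Ioo (-Real.pi) Real.pi := rfl
  rw [htarget, Measure.volume_eq_prod, ← Measure.prod_restrict, lintegral_prod _ (by
    refine Measurable.aemeasurable ?_
    simp only [smul_eq_mul]
    exact (ENNReal.measurable_ofReal.comp measurable_fst).mul (hfm.comp hsymm))]
  refine le_trans ?_ (lintegral_mono_set (s := Set.Ioo ε r) fun ρ hρ => hε.trans hρ.1)
  refine setLIntegral_mono' measurableSet_Ioo fun ρ hρ => ?_
  have hρ0 : 0 < ρ := hε.trans hρ.1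
  have hsymm' : ∀ θ : ℝ, Complex.polarCoord.symm (ρ, θ) = circleMap 0 ρ θ := fun θ => by
    rw [Complex.polarCoord_symm_apply, circleMap, Complex.exp_mul_I]; simp
  have hmem : ∀ θ : ℝ, circleMap 0 ρ θ ∈ A := fun θ => by
    simpa [hA, abs_of_pos hρ0] using hρ
  have hcont : Continuous fun θ : ℝ => F (circleMap 0 ρ θ) :=
    hFc.comp_continuous (continuous_circleMap 0 ρ) hmem
  have h1 : ∀ θ : ℝ, ENNReal.ofReal ρ • f (Complex.polarCoord.symm (ρ, θ)) =
      ENNReal.ofReal (ρ * F (circleMap 0 ρ θ)) := fun θ => by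
    rw [hsymm', hf, Set.indicator_of_mem (hmem θ), smul_eq_mul, ENNReal.ofReal_mul hρ0.le]
  simp only [h1]
  rw [← ofReal_integral_eq_lintegral_ofReal]
  · refine ENNReal.ofReal_le_ofReal ?_
    rw [← integral_Ioc_eq_integral_Ioo, ← intervalIntegral.integral_of_le
      (by linarith [Real.pi_pos]), intervalIntegral.integral_const_mul]
    -- Polar coordinates use angles in (-π, π), circle averages use (0, 2π).
    have hper : Function.Periodic (fun θ : ℝ => F (circleMap 0 ρ θ)) (2 * Real.pi) :=
      fun θ => by simp only [periodic_circleMap 0 ρ θ]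
    have h2 := hper.intervalIntegral_add_eq (-Real.pi) 0
    rw [show -Real.pi + 2 * Real.pi = Real.pi by ring, zero_add] at h2
    rw [h2]
    have h3 := hm ρ hρ
    rw [Real.circleAverage_def, smul_eq_mul, inv_mul_eq_div, le_div_iff₀ (by positivity)] at h3
    nlinarith
  · exact ((hcont.const_mul ρ).integrableOn_Icc (a := -Real.pi) (b := Real.pi)).mono_set
      Set.Ioo_subset_Icc_self
  · exact Eventually.of_forall fun θ => mul_nonneg hρ0.le (hF0 _)

/-- The Horner form in z² is the shape required by `le_circleAverage_norm_sq`. -/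
theorem hasDerivAt_comp_sq_div {φ φ₅ : ℂ → ℂ} {d₁ d₂ d₃ d₄ : ℂ}
    (hφ₅ : DifferentiableOn ℂ φ₅ (ball 0 1)) (hφ : ∀ w ∈ ball (0 : ℂ) 1, φ w =
      1 + d₁ * w + d₂ * w ^ 2 + d₃ * w ^ 3 + d₄ * w ^ 4 + w ^ 5 * φ₅ w) {z : ℂ} (hz : ‖z‖ < 1)
    (hz0 : z ≠ 0) : HasDerivAt (fun z => φ (z ^ 2) / z)
      ((-1 + z ^ 2 * (d₁ + z ^ 2 * (3 * d₂ + z ^ 2 * (5 * d₃ + z ^ 2 * (7 * d₄ + z ^ 2 *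
        (9 * φ₅ (z ^ 2) + 2 * z ^ 2 * deriv φ₅ (z ^ 2))))))) / z ^ 2) z := by
  have hsq : ∀ z : ℂ, ‖z‖ < 1 → z ^ 2 ∈ ball (0 : ℂ) 1 := fun z hz => by
    simpa using pow_lt_one₀ (norm_nonneg _) hz two_ne_zero
  have h5 : HasDerivAt φ₅ (deriv φ₅ (z ^ 2)) (z ^ 2) :=
    (hφ₅.differentiableAt (isOpen_ball.mem_nhds (hsq z hz))).hasDerivAt
  have hid := hasDerivAt_id z
  have h1 : HasDerivAt (fun z : ℂ => z⁻¹ + d₁ * z + d₂ * z ^ 3 + d₃ * z ^ 5 + d₄ * z ^ 7 +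
      z ^ 9 * φ₅ (z ^ 2)) (-(z ^ 2)⁻¹ + d₁ * 1 + d₂ * (3 * z ^ 2) + d₃ * (5 * z ^ 4) +
      d₄ * (7 * z ^ 6) + (9 * z ^ 8 * φ₅ (z ^ 2) + z ^ 9 * (deriv φ₅ (z ^ 2) * (2 * z)))) z := by
    have hp : ∀ n : ℕ, HasDerivAt (fun z : ℂ => z ^ n) (n * z ^ (n - 1)) z := fun n =>
      hasDerivAt_pow n z
    have hc : HasDerivAt (fun z : ℂ => φ₅ (z ^ 2)) (deriv φ₅ (z ^ 2) * (2 * z)) z := by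
      exact (h5.comp z (hp 2)).congr_deriv (by norm_num)
    refine (((((hasDerivAt_inv hz0).add (hid.const_mul d₁)).add ?_).add ?_).add ?_).add ?_
    · simpa using (hp 3).const_mul d₂
    · simpa using (hp 5).const_mul d₃
    · simpa using (hp 7).const_mul d₄
    · exact ((hp 9).mul hc).congr_deriv (by norm_num)
  refine (h1.congr_of_eventuallyEq ?_).congr_deriv ?_
  · filter_upwards [(isOpen_ball (x := (0 : ℂ)) (ε := 1)).eventually_mem (by simpa using hz),
      isOpen_ne.eventually_mem hz0] with w hw hw0
    have hw0' : w ≠ 0 := hw0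
    rw [hφ _ (hsq w (by simpa using hw))]
    field_simp
  · field_simp
    ring

theorem integral_area_density {ε r : ℝ} (hε : 0 < ε) (hεr : ε ≤ r) (a₁ a₂ a₃ a₄ : ℝ) :
    ∫ ρ in ε..r, 2 * Real.pi * (ρ * ((1 + a₁ * ρ ^ 4 + 9 * a₂ * ρ ^ 8 + 25 * a₃ * ρ ^ 12 +
      49 * a₄ * ρ ^ 16) / ρ ^ 4)) = Real.pi * ((ε ^ 2)⁻¹ - (r ^ 2)⁻¹ + a₁ * (r ^ 2 - ε ^ 2) +
      3 * a₂ * (r ^ 6 - ε ^ 6) + 5 * a₃ * (r ^ 10 - ε ^ 10) + 7 * a₄ * (r ^ 14 - ε ^ 14)) := by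
  have hpos : ∀ ρ ∈ Set.uIcc ε r, ρ ≠ 0 := fun ρ hρ => by
    rw [Set.uIcc_of_le hεr] at hρ
    exact (hε.trans_le hρ.1).ne'
  rw [intervalIntegral.integral_eq_sub_of_hasDerivAt (f := fun ρ => Real.pi * (-(ρ ^ 2)⁻¹ +
    a₁ * ρ ^ 2 + 3 * a₂ * ρ ^ 6 + 5 * a₃ * ρ ^ 10 + 7 * a₄ * ρ ^ 14))]
  · ring
  · intro ρ hρ
    have h0 := hpos ρ hρ
    have hp : ∀ n : ℕ, HasDerivAt (fun z : ℝ => z ^ n) (n * ρ ^ (n - 1)) ρ := fun n =>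
      hasDerivAt_pow n ρ
    refine (((((((hp 2).inv (pow_ne_zero 2 h0)).neg.add ((hp 2).const_mul a₁)).add
      ((hp 6).const_mul (3 * a₂))).add ((hp 10).const_mul (5 * a₃))).add
      ((hp 14).const_mul (7 * a₄))).const_mul Real.pi).congr_deriv ?_
    push_cast
    field_simp
    ring
  · refine ContinuousOn.intervalIntegrable ?_
    refine continuousOn_const.mul (continuousOn_id.mul (ContinuousOn.div (by fun_prop)
      (by fun_prop) fun ρ hρ => pow_ne_zero 4 (hpos ρ hρ)))

/-- By injectivity the area is the integral of |h'|²; each circle average is bounded below by the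
first five Parseval terms. -/
theorem le_volume_image_annulus {φ φ₅ : ℂ → ℂ} {d₁ d₂ d₃ d₄ : ℂ}
    (hφ₅ : DifferentiableOn ℂ φ₅ (ball 0 1)) (hφ : ∀ w ∈ ball (0 : ℂ) 1, φ w =
      1 + d₁ * w + d₂ * w ^ 2 + d₃ * w ^ 3 + d₄ * w ^ 4 + w ^ 5 * φ₅ w)
    (hinj : Set.InjOn (fun z => φ (z ^ 2) / z) (ball 0 1 \ {0})) {ε r : ℝ} (hε : 0 < ε)
    (hεr : ε ≤ r) (hr : r ≤ 1) :
    ENNReal.ofReal (Real.pi * ((ε ^ 2)⁻¹ - (r ^ 2)⁻¹ + ‖d₁‖ ^ 2 * (r ^ 2 - ε ^ 2) +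
      3 * ‖d₂‖ ^ 2 * (r ^ 6 - ε ^ 6) + 5 * ‖d₃‖ ^ 2 * (r ^ 10 - ε ^ 10) +
      7 * ‖d₄‖ ^ 2 * (r ^ 14 - ε ^ 14))) ≤
      volume ((fun z => φ (z ^ 2) / z) '' {z : ℂ | ε < ‖z‖ ∧ ‖z‖ < r}) := by
  set h : ℂ → ℂ := fun z => φ (z ^ 2) / z with hh
  set A : Set ℂ := {z : ℂ | ε < ‖z‖ ∧ ‖z‖ < r} with hA
  set χ : ℂ → ℂ := fun z => 9 * φ₅ (z ^ 2) + 2 * z ^ 2 * deriv φ₅ (z ^ 2) with hχ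
  have hAo : IsOpen A := (isOpen_lt continuous_const continuous_norm).inter
      (isOpen_lt continuous_norm continuous_const)
  have hA0 : ∀ z ∈ A, z ≠ 0 := fun z hz => norm_pos_iff.1 (hε.trans hz.1)
  have hsub : A ⊆ ball 0 1 \ {0} := fun z hz => ⟨by simpa using hz.2.trans_le hr, hA0 z hz⟩
  have hder : ∀ z ∈ A, HasDerivAt h ((-1 + z ^ 2 * (d₁ + z ^ 2 * (3 * d₂ + z ^ 2 * (5 * d₃ +
      z ^ 2 * (7 * d₄ + z ^ 2 * χ z))))) / z ^ 2) z := fun z hz =>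
    hasDerivAt_comp_sq_div hφ₅ hφ (hz.2.trans_le hr) (hA0 z hz)
  have hdiff : DifferentiableOn ℂ h A := fun z hz =>
    (hder z hz).differentiableAt.differentiableWithinAt
  have hχd : DifferentiableOn ℂ χ (ball 0 1) := by
    have hmaps : Set.MapsTo (fun z : ℂ => z ^ 2) (ball 0 1) (ball 0 1) := fun z hz => by
      simpa using pow_lt_one₀ (norm_nonneg _) (by simpa using hz) two_ne_zero
    have h1 : DifferentiableOn ℂ (fun z => φ₅ (z ^ 2)) (ball 0 1) :=
      hφ₅.comp (by fun_prop) hmaps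
    have h2 : DifferentiableOn ℂ (fun z => deriv φ₅ (z ^ 2)) (ball 0 1) :=
      (hφ₅.deriv isOpen_ball).comp (by fun_prop) hmaps
    fun_prop
  rw [← lintegral_abs_det_fderiv_eq_addHaar_image volume hAo.measurableSet
    (fun z hz => (hder z hz).differentiableAt.hasDerivAt.complexToReal_fderiv.hasFDerivWithinAt)
    (hinj.mono hsub)]
  simp only [abs_det_smul_one_complex]
  refine le_trans ?_ (setLIntegral_annulus_ge (F := fun z => ‖deriv h z‖ ^ 2)
    ((measurable_deriv h).norm.pow_const 2) hε ?_ (fun z => by positivity)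
    (m := fun ρ => (1 + ‖d₁‖ ^ 2 * ρ ^ 4 + 9 * ‖d₂‖ ^ 2 * ρ ^ 8 + 25 * ‖d₃‖ ^ 2 * ρ ^ 12 +
      49 * ‖d₄‖ ^ 2 * ρ ^ 16) / ρ ^ 4) ?_)
  · rw [← integral_area_density hε hεr, intervalIntegral.integral_of_le hεr,
      integral_Ioc_eq_integral_Ioo, ofReal_integral_eq_lintegral_ofReal]
    · refine (ContinuousOn.integrableOn_Icc ?_).mono_set Set.Ioo_subset_Icc_self
      refine continuousOn_const.mul (continuousOn_id.mul (ContinuousOn.div (by fun_prop)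
        (by fun_prop) fun ρ hρ => pow_ne_zero 4 (hε.trans_le hρ.1).ne'))
    · refine (ae_restrict_iff' measurableSet_Ioo).2 (Eventually.of_forall fun ρ hρ => ?_)
      have : 0 < ρ := hε.trans hρ.1
      simp only [Pi.zero_apply]
      positivity
  · exact (hdiff.deriv hAo).continuousOn.norm.pow 2
  · intro ρ hρ
    have hρ0 : 0 < ρ := hε.trans hρ.1
    have h1 := le_circleAverage_norm_sq (-1) d₁ (3 * d₂) (5 * d₃) (7 * d₄) hχd hρ0.le
      (hρ.2.trans_le hr)
    have h2 : Real.circleAverage (fun z => ‖deriv h z‖ ^ 2) 0 ρ =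
        Real.circleAverage (fun z => (ρ ^ 4)⁻¹ • ‖-1 + z ^ 2 * (d₁ + z ^ 2 * (3 * d₂ + z ^ 2 *
          (5 * d₃ + z ^ 2 * (7 * d₄ + z ^ 2 * χ z))))‖ ^ 2) 0 ρ := by
      apply Real.circleAverage_congr_sphere
      intro z hz
      have hz' : ‖z‖ = ρ := by simpa [abs_of_pos hρ0] using hz
      have hzA : z ∈ A := by rw [hA, Set.mem_ofPred_eq, hz']; exact hρ
      simp only [(hder z hzA).deriv, norm_div, norm_pow, hz', smul_eq_mul]
      field_simp
    rw [h2, Real.circleAverage_fun_smul, smul_eq_mul, div_eq_inv_mul]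
    refine mul_le_mul_of_nonneg_left (le_trans (le_of_eq ?_) h1) (by positivity)
    simp only [norm_mul, norm_neg, norm_one, Complex.norm_ofNat]
    ring

theorem area_theorem_on_disc {φ φ₅ : ℂ → ℂ} {d₁ d₂ d₃ d₄ : ℂ}
    (hφ₅ : DifferentiableOn ℂ φ₅ (ball 0 1)) (hφ : ∀ w ∈ ball (0 : ℂ) 1, φ w =
      1 + d₁ * w + d₂ * w ^ 2 + d₃ * w ^ 3 + d₄ * w ^ 4 + w ^ 5 * φ₅ w)
    (hinj : Set.InjOn (fun z => φ (z ^ 2) / z) (ball 0 1 \ {0})) {r : ℝ} (hr0 : 0 < r)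
    (hr : r ≤ 1) :
    ‖d₁‖ ^ 2 * r ^ 2 + 3 * ‖d₂‖ ^ 2 * r ^ 6 + 5 * ‖d₃‖ ^ 2 * r ^ 10 + 7 * ‖d₄‖ ^ 2 * r ^ 14 ≤
      (r ^ 2)⁻¹ := by
  set ψ : ℂ → ℂ := fun w => d₂ + d₃ * w + d₄ * w ^ 2 + w ^ 3 * φ₅ w with hψ
  have hψd : DifferentiableOn ℂ ψ (ball 0 1) := by fun_prop
  have hφd : DifferentiableOn ℂ φ (ball 0 1) := by
    refine DifferentiableOn.congr (f := fun w =>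
      1 + d₁ * w + d₂ * w ^ 2 + d₃ * w ^ 3 + d₄ * w ^ 4 + w ^ 5 * φ₅ w) ?_ hφ
    fun_prop
  have hφψ : ∀ w ∈ ball (0 : ℂ) 1, φ w = 1 + d₁ * w + w ^ 2 * ψ w := fun w hw => by
    rw [hφ w hw]; ring
  obtain ⟨K, hK⟩ := (isCompact_closedBall (0 : ℂ) (1 / 2)).exists_bound_of_continuousOn
    (hψd.continuousOn.mono (closedBall_subset_ball (by norm_num)))
  have hK0 : 0 ≤ K := (norm_nonneg _).trans (hK 0 (by simp))
  let P : ℝ → ℝ := fun ε => -(r ^ 2)⁻¹ + ‖d₁‖ ^ 2 * (r ^ 2 - ε ^ 2) +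
      3 * ‖d₂‖ ^ 2 * (r ^ 6 - ε ^ 6) + 5 * ‖d₃‖ ^ 2 * (r ^ 10 - ε ^ 10) +
      7 * ‖d₄‖ ^ 2 * (r ^ 14 - ε ^ 14) - (4 * K * ε ^ 2 + 8 * K ^ 2 * ε ^ 6)
  have hlim : Tendsto P (𝓝[>] 0) (𝓝 (P 0)) := by
    have : Continuous P := by fun_prop
    exact this.continuousAt.tendsto.mono_left nhdsWithin_le_nhds
  have hsmall : ∀ᶠ ε : ℝ in 𝓝[>] 0, ‖d₁‖ * ε ^ 2 < 1 / 2 := by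
    have : Tendsto (fun ε : ℝ => ‖d₁‖ * ε ^ 2) (𝓝 0) (𝓝 (‖d₁‖ * 0 ^ 2)) :=
      Continuous.tendsto (by fun_prop) 0
    refine (this.mono_left nhdsWithin_le_nhds).eventually_lt_const ?_
    norm_num
  have hle : ∀ᶠ ε : ℝ in 𝓝[>] 0, P ε ≤ 0 := by
    filter_upwards [hsmall, Ioo_mem_nhdsGT (show (0 : ℝ) < min r (1 / 2) by positivity)]
      with ε hε1 hε2
    have hε0 : 0 < ε := hε2.1
    have hεr : ε ≤ r := (hε2.2.trans_le (min_le_left _ _)).le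
    have hε3 : ε ≤ 1 / 2 := (hε2.2.trans_le (min_le_right _ _)).le
    have h1 := le_volume_image_annulus hφ₅ hφ hinj hε0 hεr hr
    have h2 := volume_image_annulus_le hφd hφψ hinj hε0 hε3 hK hr hε1.le
    have h3 := (mul_le_mul_right h1 _).trans h2
    set q : ℝ := 1 - (‖d₁‖ * ε ^ 2) ^ 2 with hq
    have hq1 : q ≤ 1 := by rw [hq]; nlinarith [sq_nonneg (‖d₁‖ * ε ^ 2)]
    have hq0 : 1 / 2 ≤ q := by
      have : 0 ≤ ‖d₁‖ * ε ^ 2 := by positivity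
      rw [hq]; nlinarith
    rw [← ENNReal.ofReal_mul (by linarith), ENNReal.ofReal_le_ofReal_iff (by positivity)] at h3
    set X : ℝ := -(r ^ 2)⁻¹ + ‖d₁‖ ^ 2 * (r ^ 2 - ε ^ 2) +
      3 * ‖d₂‖ ^ 2 * (r ^ 6 - ε ^ 6) + 5 * ‖d₃‖ ^ 2 * (r ^ 10 - ε ^ 10) +
      7 * ‖d₄‖ ^ 2 * (r ^ 14 - ε ^ 14) with hX
    have h4 : q * ((ε ^ 2)⁻¹ + X) ≤ (q / ε + 2 * K * ε ^ 3) ^ 2 := by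
      have h5 : Real.pi * (q * ((ε ^ 2)⁻¹ + X)) ≤ Real.pi * (q / ε + 2 * K * ε ^ 3) ^ 2 := by
        refine le_trans (le_of_eq ?_) h3
        rw [hX]; ring
      exact le_of_mul_le_mul_left h5 Real.pi_pos
    have h6 : (q / ε + 2 * K * ε ^ 3) ^ 2 =
        q * (q * (ε ^ 2)⁻¹ + 4 * K * ε ^ 2) + 4 * K ^ 2 * ε ^ 6 := by
      field_simp; ring
    have h7 : q * (ε ^ 2)⁻¹ ≤ (ε ^ 2)⁻¹ := mul_le_of_le_one_left (by positivity) hq1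
    -- The bound q ≥ 1/2 makes q a common factor, which is then cancelled.
    have h8 : 4 * K ^ 2 * ε ^ 6 ≤ q * (8 * K ^ 2 * ε ^ 6) := by
      nlinarith [show 0 ≤ K ^ 2 * ε ^ 6 by positivity]
    have h9 : q * ((ε ^ 2)⁻¹ + X) ≤ q * ((ε ^ 2)⁻¹ + (4 * K * ε ^ 2 + 8 * K ^ 2 * ε ^ 6)) := by
      rw [h6] at h4
      nlinarith [mul_le_mul_of_nonneg_left h7 (show 0 ≤ q by linarith)]
    have h10 := le_of_mul_le_mul_left h9 (by linarith)
    show X - (4 * K * ε ^ 2 + 8 * K ^ 2 * ε ^ 6) ≤ 0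
    linarith
  have h0 := le_of_tendsto hlim hle
  simp only [P] at h0
  norm_num at h0
  linarith

/-- **Area theorem** for odd functions `z⁻¹ * φ (z ^ 2)`, truncated after four coefficients. -/
theorem area_theorem {φ φ₅ : ℂ → ℂ} {d₁ d₂ d₃ d₄ : ℂ}
    (hφ₅ : DifferentiableOn ℂ φ₅ (ball 0 1)) (hφ : ∀ w ∈ ball (0 : ℂ) 1, φ w =
      1 + d₁ * w + d₂ * w ^ 2 + d₃ * w ^ 3 + d₄ * w ^ 4 + w ^ 5 * φ₅ w)
    (hinj : Set.InjOn (fun z => φ (z ^ 2) / z) (ball 0 1 \ {0})) :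
    ‖d₁‖ ^ 2 + 3 * ‖d₂‖ ^ 2 + 5 * ‖d₃‖ ^ 2 + 7 * ‖d₄‖ ^ 2 ≤ 1 := by
  simpa using area_theorem_on_disc hφ₅ hφ hinj one_pos le_rfl

/-! ### Taylor coefficients, logarithms and exponentials -/

theorem iterate_dslope_apply_self {F : ℂ → ℂ} {z₀ : ℂ} (hF : AnalyticAt ℂ F z₀) (n : ℕ) :
    (Function.swap dslope z₀)^[n] F z₀ = iteratedDeriv n F z₀ / n.factorial := by
  have hp := hF.hasFPowerSeriesAt
  have h := hp.has_fpower_series_iterate_dslope_fslope n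
  rw [← h.coeff_zero 1, ← FormalMultilinearSeries.coeff,
    FormalMultilinearSeries.coeff_iterate_fslope, FormalMultilinearSeries.coeff_ofScalars]
  simp

theorem differentiableOn_iterate_dslope {F : ℂ → ℂ} {s : Set ℂ} {z₀ : ℂ} (hs : s ∈ 𝓝 z₀)
    (hF : DifferentiableOn ℂ F s) (n : ℕ) :
    DifferentiableOn ℂ ((Function.swap dslope z₀)^[n] F) s := by
  induction n with
  | zero => exact hF
  | succ n ih =>
    rw [Function.iterate_succ_apply']
    exact (Complex.differentiableOn_dslope hs).2 ih

theorem iterate_dslope_eq_add_mul (F : ℂ → ℂ) (n : ℕ) (w : ℂ) :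
    (Function.swap dslope 0)^[n] F w = (Function.swap dslope 0)^[n] F 0 +
      w * (Function.swap dslope 0)^[n + 1] F w := by
  rw [Function.iterate_succ_apply']
  have := sub_smul_dslope ((Function.swap dslope 0)^[n] F) 0 w
  simp only [sub_zero, smul_eq_mul] at this
  show _ = _ + w * dslope _ 0 w
  rw [this]; ring

/-- A nonvanishing holomorphic function on a disc has a holomorphic logarithm. -/
theorem exists_exp_eq_of_differentiableOn_ball {g : ℂ → ℂ} {R : ℝ}
    (hg : DifferentiableOn ℂ g (ball 0 R)) (hg0 : g 0 = 1) (hR : 0 < R)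
    (hne : ∀ z ∈ ball (0 : ℂ) R, g z ≠ 0) :
    ∃ L : ℂ → ℂ, DifferentiableOn ℂ L (ball 0 R) ∧ L 0 = 0 ∧
      ∀ z ∈ ball (0 : ℂ) R, Complex.exp (L z) = g z := by
  obtain ⟨L, hL0, hL⟩ := (((hg.deriv isOpen_ball).div hg hne).isExactOn_ball).with_val_at 0 0
  refine ⟨L, fun z hz => (hL z hz).differentiableAt.differentiableWithinAt, hL0, fun z hz => ?_⟩
  have hd : ∀ z ∈ ball (0 : ℂ) R, HasDerivAt (fun z => g z * Complex.exp (-L z)) 0 z := by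
    intro z hz
    refine ((hg.differentiableAt (isOpen_ball.mem_nhds hz)).hasDerivAt.mul
      (hL z hz).neg.cexp).congr_deriv ?_
    have := hne z hz
    simp only [Pi.div_apply]
    field_simp
    ring
  have hc := isOpen_ball.is_const_of_deriv_eq_zero (convex_ball (0 : ℂ) R).isPreconnected
    (fun z hz => (hd z hz).differentiableAt.differentiableWithinAt)
    (fun z hz => (hd z hz).deriv) hz (mem_ball_self hR)
  simp only [hL0, hg0, neg_zero, Complex.exp_zero, mul_one] at hc
  have h2 : Complex.exp (-L z) * Complex.exp (L z) = 1 := by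
    rw [← Complex.exp_add]; simp
  linear_combination Complex.exp (L z) * hc.symm + g z * h2

theorem iteratedDeriv_succ_cexp {L : ℂ → ℂ} {z₀ : ℂ} (hL : AnalyticAt ℂ L z₀) (c : ℂ) (n : ℕ) :
    iteratedDeriv (n + 1) (fun z => Complex.exp (c * L z)) z₀ =
      c * ∑ i ∈ Finset.range (n + 1), n.choose i * iteratedDeriv (i + 1) L z₀ *
        iteratedDeriv (n - i) (fun z => Complex.exp (c * L z)) z₀ := by
  have hφ : AnalyticAt ℂ (fun z => Complex.exp (c * L z)) z₀ := by fun_prop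
  have hev : deriv (fun z => Complex.exp (c * L z)) =ᶠ[𝓝 z₀]
      fun z => c * (deriv L * fun z => Complex.exp (c * L z)) z := by
    filter_upwards [hL.eventually_analyticAt] with z hz
    have := (hz.differentiableAt.hasDerivAt.const_mul c).cexp.deriv
    rw [this]
    simp only [Pi.mul_apply]
    ring
  rw [iteratedDeriv_succ', hev.iteratedDeriv_eq, iteratedDeriv_const_mul_field,
    iteratedDeriv_mul hL.deriv.contDiffAt hφ.contDiffAt]
  simp only [iteratedDeriv_succ']

/-- The Leibniz rule applied to φ' = -L'φ/2 gives a recursion between the derivatives of φ and L at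
0. The sign in c makes every coefficient of the resulting polynomial positive, as in `boundValues`.
-/
theorem iteratedDeriv_four_eq_of_exp {L φ : ℂ → ℂ} (hL : AnalyticAt ℂ L 0) (hL0 : L 0 = 0)
    (hφ : φ = fun z => Complex.exp (-(1 / 2) * L z)) {c : ℕ → ℂ}
    (hc : ∀ n, c n = -(iteratedDeriv n φ 0 / n.factorial)) :
    iteratedDeriv 4 L 0 / 24 / 2 =
      c 4 + c 1 * c 3 + c 2 ^ 2 / 2 + c 1 ^ 2 * c 2 + c 1 ^ 4 / 4 := by
  have h := iteratedDeriv_succ_cexp hL (-(1 / 2))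
  rw [← hφ] at h
  have h0 : iteratedDeriv 0 φ 0 = 1 := by simp [hφ, hL0]
  have h1 := h 0
  have h2 := h 1
  have h3 := h 2
  have h4 := h 3
  simp only [Finset.sum_range_succ, Finset.range_zero, Finset.sum_empty, Nat.choose, h0,
    Nat.reduceAdd, Nat.reduceSub, Nat.cast_one, Nat.cast_ofNat] at h1 h2 h3 h4
  rw [hc 1, hc 2, hc 3, hc 4]
  simp only [Nat.factorial]
  rw [h4, h3, h2, h1]
  ring

/-! ### Application to the class S -/

theorem IsClassS.exists_coeff {f : ℂ → ℂ} (hf : IsClassS f) : ∃ c₁ c₂ c₃ c₄ : ℂ,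
    ‖c₁‖ ^ 2 + 3 * ‖c₂‖ ^ 2 + 5 * ‖c₃‖ ^ 2 + 7 * ‖c₄‖ ^ 2 ≤ 1 ∧
    logCoeff f 4 = c₄ + c₁ * c₃ + c₂ ^ 2 / 2 + c₁ ^ 2 * c₂ + c₁ ^ 4 / 4 := by
  have hnhds : ball (0 : ℂ) 1 ∈ 𝓝 0 := ball_mem_nhds 0 one_pos
  set g : ℂ → ℂ := dslope f 0 with hg
  have hgd : DifferentiableOn ℂ g (ball 0 1) :=
    (Complex.differentiableOn_dslope hnhds).2 hf.differentiableOn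
  have hg0 : g 0 = 1 := by rw [hg, dslope_same, hf.deriv_zero]
  have hfg : ∀ z, f z = z * g z := fun z => by
    have := sub_smul_dslope f 0 z
    simpa [hf.map_zero] using this.symm
  have hgne : ∀ z ∈ ball (0 : ℂ) 1, g z ≠ 0 := by
    intro z hz h0
    have h1 : f z = f 0 := by rw [hfg, h0, hf.map_zero, mul_zero]
    have h2 := hf.injOn hz (mem_ball_self one_pos) h1
    rw [h2, hg0] at h0
    exact one_ne_zero h0
  obtain ⟨L, hLd, hL0, hLg⟩ := exists_exp_eq_of_differentiableOn_ball hgd hg0 one_pos hgne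
  have hLa : AnalyticAt ℂ L 0 := hLd.analyticAt hnhds
  have hlog : (fun z => Complex.log (dslope f 0 z)) =ᶠ[𝓝 0] L := by
    have hcont : ContinuousAt (fun z => |(L z).im|) 0 :=
      (Complex.continuous_im.continuousAt.comp hLa.continuousAt).abs
    have hlt : ∀ᶠ z in 𝓝 (0 : ℂ), |(L z).im| < Real.pi :=
      hcont.eventually_lt_const (by simpa [hL0] using Real.pi_pos)
    filter_upwards [hlt, hnhds] with z hz hz1
    rw [← hg, ← hLg z hz1, Complex.log_exp (abs_lt.1 hz).1 (abs_lt.1 hz).2.le]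
  set φ : ℂ → ℂ := fun z => Complex.exp (-(1 / 2) * L z) with hφ
  have hφd : DifferentiableOn ℂ φ (ball 0 1) := by fun_prop
  have hφsq : ∀ z ∈ ball (0 : ℂ) 1, φ z ^ 2 * g z = 1 := by
    intro z hz
    rw [← hLg z hz, hφ, ← Complex.exp_nat_mul, ← Complex.exp_add]
    convert Complex.exp_zero using 2
    push_cast
    ring
  have hinj : Set.InjOn (fun z => φ (z ^ 2) / z) (ball 0 1 \ {0}) := by
    have hmaps : ∀ z ∈ ball (0 : ℂ) 1 \ {0}, z ^ 2 ∈ ball (0 : ℂ) 1 := fun z hz => by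
      simpa using pow_lt_one₀ (norm_nonneg _) (by simpa using hz.1) two_ne_zero
    have key : ∀ z ∈ ball (0 : ℂ) 1 \ {0}, f (z ^ 2) = ((φ (z ^ 2) / z) ^ 2)⁻¹ := by
      intro z hz
      have h1 := hφsq _ (hmaps z hz)
      have hz0 : z ≠ 0 := hz.2
      have hφ0 : φ (z ^ 2) ≠ 0 := Complex.exp_ne_zero _
      rw [hfg]
      field_simp
      linear_combination h1
    intro z hz w hw hzw
    have hzw' : φ (z ^ 2) / z = φ (w ^ 2) / w := hzw
    have h1 : f (z ^ 2) = f (w ^ 2) := by rw [key z hz, key w hw, hzw']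
    have h2 := hf.injOn (hmaps z hz) (hmaps w hw) h1
    -- Univalence of f only yields z = ±w; the minus sign is impossible because h is odd and
    -- nonvanishing.
    rcases sq_eq_sq_iff_eq_or_eq_neg.1 h2 with h3 | h3
    · exact h3
    · exfalso
      have hw0 : w ≠ 0 := hw.2
      have hφ0 : φ (w ^ 2) ≠ 0 := Complex.exp_ne_zero _
      rw [h2, h3] at hzw'
      field_simp at hzw'
      norm_num at hzw'
  let c : ℕ → ℂ := fun n => -(iteratedDeriv n φ 0 / n.factorial)
  have hφa : AnalyticAt ℂ φ 0 := hφd.analyticAt hnhds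
  have hd : ∀ n, (Function.swap dslope 0)^[n] φ 0 = -c n := fun n => by
    rw [iterate_dslope_apply_self hφa]; simp [c]
  have harea := area_theorem (d₁ := -c 1) (d₂ := -c 2) (d₃ := -c 3) (d₄ := -c 4)
    (differentiableOn_iterate_dslope hnhds hφd 5) (fun w _ => by
      have e0 := iterate_dslope_eq_add_mul φ 0 w
      have e1 := iterate_dslope_eq_add_mul φ 1 w
      have e2 := iterate_dslope_eq_add_mul φ 2 w
      have e3 := iterate_dslope_eq_add_mul φ 3 w
      have e4 := iterate_dslope_eq_add_mul φ 4 w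
      have hφ0 : φ 0 = 1 := by simp [hφ, hL0]
      simp only [hd 1, hd 2, hd 3, hd 4, Nat.reduceAdd] at e0 e1 e2 e3 e4
      rw [Function.iterate_zero, id, hφ0] at e0
      rw [e0, e1, e2, e3, e4]
      ring) hinj
  refine ⟨c 1, c 2, c 3, c 4, by simpa only [norm_neg] using harea, ?_⟩
  rw [← iteratedDeriv_four_eq_of_exp hLa hL0 hφ fun n => rfl, logCoeff, hlog.iteratedDeriv_eq]
  norm_num [Nat.factorial]

theorem IsClassS.exists_norm_logCoeff_four_le {f : ℂ → ℂ} (hf : IsClassS f) :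
    ∃ m ∈ boundValues, ‖logCoeff f 4‖ ≤ m := by
  obtain ⟨c₁, c₂, c₃, c₄, h, hlog⟩ := hf.exists_coeff
  refine ⟨_, ⟨‖c₁‖, ‖c₂‖, ‖c₃‖, ‖c₄‖, norm_nonneg _, norm_nonneg _, norm_nonneg _, norm_nonneg _,
    h, rfl⟩, ?_⟩
  rw [hlog]
  refine (norm_add_le _ _).trans ((add_le_add (norm_add_le _ _) le_rfl).trans
    ((add_le_add (add_le_add (norm_add_le _ _) le_rfl) le_rfl).trans
    ((add_le_add (add_le_add (add_le_add (norm_add_le _ _) le_rfl) le_rfl) le_rfl).trans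
    (le_of_eq ?_))))
  simp only [norm_mul, norm_div, norm_pow, Complex.norm_ofNat]
  ring

theorem theorem1 :
    ∃ M : ℝ, IsGreatest boundValues M ∧ (0.51059 : ℝ) ≤ M ∧ M < (0.51060 : ℝ) ∧
      ∀ f : ℂ → ℂ, IsClassS f → ‖logCoeff f 4‖ ≤ M := by
  obtain ⟨m, hm, hm1⟩ := exists_boundValues_ge
  obtain ⟨M, hM⟩ := isCompact_boundValues.exists_isGreatest ⟨m, hm⟩
  refine ⟨M, hM, hm1.trans (hM.2 hm), (boundValues_le hM.1).trans_lt (by norm_num), fun f hf => ?_⟩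
  obtain ⟨v, hv, hle⟩ := hf.exists_norm_logCoeff_four_le
  exact hle.trans (hM.2 hv)
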